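/- Write $(a;q)_m=\prod_{j=0}^{m-1}(1-aq^j)$, $(a;q)_\infty=\prod_{j=0}^{\infty}(1-aq^j)$ and $(a_1,\dots,a_s;q)_\infty=(a_1;q)_\infty\cdots(a_s;q)_\infty$. The following two identities hold, both for every complex number $q$ with $|q|<1$ (the double series converging absolutely) and as identities of formal power series in $q$ with integer coefficients: $$\sum_{n,r\ge 0}\frac{q^{\frac12 n^2+\frac12 n+nr+\frac32 r^2+\frac12 r}\,(-1;q)_{n+r}}{(q;q)_n\,(q;q)_r\,(q;q^2)_r}=\frac{(q^9,q^9,q^{18};q^{18})_\infty\,(-q;q)_\infty}{(q;q)_\infty},$$ $$\sum_{\substack{n,r\ge 0\\ 2r\le n}}\frac{q^{n(n+1)/2+2r^2}\,(-1;q)_n}{(q;q^2)_n\,(q^2;q^2)_r\,(q^2;q^4)_r\,(q;q)_{n-2r}}=\frac{(q^{22},q^{22},q^{44};q^{44})_\infty\,(-q;q)_\infty}{(q;q)_\infty}.$$ -/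

import Mathlib

open scoped PowerSeries.WithPiTopology

/-- The finite `q`-shifted factorial `(a; q)_n = (1 - a) (1 - a q) ⋯ (1 - a q ^ (n - 1))`. -/
def qPoch {R : Type*} [CommRing R] (a q : R) (n : ℕ) : R :=
  ∏ j ∈ Finset.range n, (1 - a * q ^ j)

/-- The infinite `q`-shifted factorial `(a; q)_∞ = ∏_{j ≥ 0} (1 - a q ^ j)`; the product converges
in the two settings in which it is used, by the two facts below. -/
noncomputable def qPochInf {R : Type*} [CommRing R] [TopologicalSpace R] (a q : R) : R :=
  ∏' j : ℕ, (1 - a * q ^ j)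

theorem qPochInf_multipliable_complex (a q : ℂ) (hq : ‖q‖ < 1) :
    Multipliable fun j : ℕ => 1 - a * q ^ j := by
  have h : Summable fun j : ℕ => ‖-(a * q ^ j)‖ := by
    simp only [norm_neg, norm_mul, norm_pow]
    exact (summable_geometric_of_lt_one (norm_nonneg q) hq).mul_left _
  simpa [sub_eq_add_neg] using multipliable_one_add_of_summable h

theorem qPochInf_multipliable_powerSeries (a q : PowerSeries ℤ)
    (hq : PowerSeries.constantCoeff q = 0) :
    Multipliable fun j : ℕ => 1 - a * q ^ j := by
  have h : Filter.Tendsto (fun j : ℕ => (-(a * q ^ j)).order) Filter.atTop (nhds ⊤) := by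
    rw [ENat.tendsto_nhds_top_iff_natCast_lt]
    intro n
    filter_upwards [Filter.eventually_gt_atTop n] with j hj
    rw [PowerSeries.order_neg]
    have h1 : (j : ℕ∞) ≤ (a * q ^ j).order := by
      apply PowerSeries.le_order
      intro i hi
      have hd : (PowerSeries.X : PowerSeries ℤ) ^ j ∣ a * q ^ j :=
        Dvd.dvd.mul_left (pow_dvd_pow_of_dvd (PowerSeries.X_dvd_iff.mpr hq) j) a
      exact PowerSeries.X_pow_dvd_iff.mp hd i (by exact_mod_cast hi)
    exact lt_of_lt_of_le (by exact_mod_cast hj) h1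
  simpa [sub_eq_add_neg] using
    PowerSeries.WithPiTopology.multipliable_one_add_of_tendsto_order_atTop_nhds_top ℤ h

/-- The reciprocal of an integral formal power series with constant term `1`. -/
noncomputable def recip (f : PowerSeries ℤ) : PowerSeries ℤ := PowerSeries.invOfUnit f 1

theorem mul_recip (f : PowerSeries ℤ) (hf : PowerSeries.constantCoeff f = 1) :
    f * recip f = 1 :=
  PowerSeries.mul_invOfUnit f 1 (by simpa using hf)

theorem constantCoeff_qPoch (a q : PowerSeries ℤ) (ha : PowerSeries.constantCoeff a = 0) (n : ℕ) :
    PowerSeries.constantCoeff (qPoch a q n) = 1 := by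
  simp [qPoch, map_prod, ha]

theorem constantCoeff_qPochInf (a q : PowerSeries ℤ) (ha : PowerSeries.constantCoeff a = 0)
    (hq : PowerSeries.constantCoeff q = 0) :
    PowerSeries.constantCoeff (qPochInf a q) = 1 := by
  have h := (qPochInf_multipliable_powerSeries a q hq).map_tprod
    (PowerSeries.constantCoeff (R := ℤ))
    (PowerSeries.WithPiTopology.continuous_constantCoeff ℤ)
  simpa [qPochInf, ha] using h

/-! Both identities are Bailey chains. A Bailey pair relative to 1 satisfies β_n = Σ_j α_j /
((q;q)_{n-j} (q;q)_{n+j}). Three moves make new pairs from old: Bailey's lemma with both parameters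
infinite (`sum_pow_sq_mul_baileySum`) multiplies α_k by q^(k²); the change of base from q² to q
(`sum_pow_sq_mul_baileySum_sq`) moves α_k to index 2k with a factor q^(2k²); Bailey's lemma with
parameters -1 and ∞ (`sum_qPoch_neg_one_mul_baileySum`) contributes 2 q^(k(k+1)/2) / (1 + q^k). Each
rests on a finite summation proved by induction from a q-Pascal recurrence.

The chains start at the unit pair, whose β is 1 at 0 and 0 elsewhere. One change of base followed by
the two forms of Bailey's lemma gives the first double sum; two changes of base (q⁴ to q² to q)
followed by the last move give the second. The last move cancels the factor 1 + q^(dj) of the unit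
pair (d = 2 or 4), leaving 2(-1)^j q^(9j²) and 2(-1)^j q^(22j²) for j ≥ 1. As the outer index L
tends to infinity, dominated convergence turns the chain into a theta series times (-q;q)_∞/(q;q)_∞.
Gauss's product for the theta series comes from the shortest chain.

The limit is taken in any complete normed commutative ring with ‖1‖ = 1, at ‖q‖ < 1. This covers ℂ,
and also ℤ[[X]] with the X-adic norm. -/

/-! ### Finite q-series summations -/

section Finite

variable {R : Type*} [CommRing R]

/-- The reciprocal `1 / (q; q)_m`, extended by `0` to negative `m`. -/
noncomputable def invPoch (q : R) (m : ℤ) : R :=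
  if 0 ≤ m then Ring.inverse (qPoch q q m.toNat) else 0

theorem qPoch_zero (a q : R) : qPoch a q 0 = 1 := by simp [qPoch]

theorem qPoch_succ (a q : R) (n : ℕ) : qPoch a q (n + 1) = qPoch a q n * (1 - a * q ^ n) :=
  Finset.prod_range_succ _ _

theorem qPoch_succ' (a q : R) (n : ℕ) : qPoch a q (n + 1) = (1 - a) * qPoch (a * q) q n := by
  simp only [qPoch, Finset.prod_range_succ', pow_zero, mul_one]
  rw [mul_comm]
  congr 1
  exact Finset.prod_congr rfl fun j _ => by ring

theorem qPoch_add (a q : R) (m n : ℕ) :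
    qPoch a q (m + n) = qPoch a q m * qPoch (a * q ^ m) q n := by
  simp only [qPoch, Finset.prod_range_add]
  congr 1
  exact Finset.prod_congr rfl fun j _ => by ring

theorem invPoch_of_neg (q : R) {m : ℤ} (h : m < 0) : invPoch q m = 0 := by
  simp [invPoch, not_le.mpr h]

theorem invPoch_natCast (q : R) (n : ℕ) : invPoch q n = Ring.inverse (qPoch q q n) := by
  simp [invPoch]

theorem invPoch_zero (q : R) : invPoch q 0 = 1 := by
  simp [invPoch, qPoch_zero]

variable {q : R}

theorem isUnit_one_sub_pow (hq : ∀ n : ℕ, IsUnit (1 - q ^ (n + 1))) {n : ℕ} (hn : n ≠ 0) :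
    IsUnit (1 - q ^ n) := by
  obtain ⟨m, rfl⟩ := Nat.exists_eq_succ_of_ne_zero hn
  exact hq m

theorem isUnit_one_sub_pow_pow (hq : ∀ n : ℕ, IsUnit (1 - q ^ (n + 1))) {d : ℕ} (hd : d ≠ 0)
    (n : ℕ) : IsUnit (1 - (q ^ d) ^ (n + 1)) := by
  rw [← pow_mul]
  exact isUnit_one_sub_pow hq (by positivity)

theorem isUnit_one_add_pow (hq : ∀ n : ℕ, IsUnit (1 - q ^ (n + 1))) {n : ℕ} (hn : n ≠ 0) :
    IsUnit (1 + q ^ n) := by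
  have h := isUnit_one_sub_pow hq (n := n * 2) (by positivity)
  rw [pow_mul, show 1 - (q ^ n) ^ 2 = (1 - q ^ n) * (1 + q ^ n) by ring] at h
  exact isUnit_of_mul_isUnit_right h

theorem isUnit_qPoch_self (hq : ∀ n : ℕ, IsUnit (1 - q ^ (n + 1))) (n : ℕ) :
    IsUnit (qPoch q q n) :=
  (Finset.prod_induction _ IsUnit (fun _ _ => IsUnit.mul) isUnit_one fun j _ => by
    rw [← pow_succ']; exact hq j)

theorem isUnit_qPoch_odd (hq : ∀ n : ℕ, IsUnit (1 - q ^ (n + 1))) (n : ℕ) :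
    IsUnit (qPoch q (q ^ 2) n) :=
  (Finset.prod_induction _ IsUnit (fun _ _ => IsUnit.mul) isUnit_one fun j _ => by
    rw [← pow_mul, ← pow_succ']; exact hq _)

theorem isUnit_qPoch_neg (hq : ∀ n : ℕ, IsUnit (1 - q ^ (n + 1))) (n : ℕ) :
    IsUnit (qPoch (-q) q n) :=
  (Finset.prod_induction _ IsUnit (fun _ _ => IsUnit.mul) isUnit_one fun j _ => by
    rw [neg_mul, sub_neg_eq_add, ← pow_succ']; exact isUnit_one_add_pow hq (by simp))

/-- At `k = 0` both sides are 0, so the convention at negative indices removes boundary cases from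
the recurrences. -/
theorem one_sub_pow_mul_invPoch (hq : ∀ n : ℕ, IsUnit (1 - q ^ (n + 1))) {m : ℤ} (k : ℕ)
    (h : m = k) : (1 - q ^ k) * invPoch q m = invPoch q (m - 1) := by
  subst h
  cases k with
  | zero => simp [invPoch_of_neg]
  | succ n =>
    rw [show ((n + 1 : ℕ) : ℤ) - 1 = (n : ℕ) by push_cast; ring, invPoch_natCast, invPoch_natCast,
      qPoch_succ, ← pow_succ', Ring.mul_inverse_rev, ← mul_assoc, Ring.mul_inverse_cancel _ (hq n),
      one_mul]

theorem qPoch_mul_invPoch (hq : ∀ n : ℕ, IsUnit (1 - q ^ (n + 1))) (n : ℕ) :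
    qPoch q q n * invPoch q n = 1 := by
  rw [invPoch_natCast, Ring.mul_inverse_cancel _ (isUnit_qPoch_self hq n)]

theorem qPoch_odd_mul_even (q : R) (n : ℕ) :
    qPoch q (q ^ 2) n * qPoch (q ^ 2) (q ^ 2) n = qPoch q q (2 * n) := by
  induction n with
  | zero => simp [qPoch]
  | succ n ih =>
    rw [mul_add_one, qPoch_succ, qPoch_succ, qPoch_succ _ _ (2 * n + 1), qPoch_succ _ _ (2 * n),
      ← ih]
    ring

theorem qPoch_mul_neg (q : R) (n : ℕ) :
    qPoch q q n * qPoch (-q) q n = qPoch (q ^ 2) (q ^ 2) n := by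
  simp only [qPoch, ← Finset.prod_mul_distrib]
  exact Finset.prod_congr rfl fun j _ => by ring

theorem invPoch_sq_eq (hq : ∀ n : ℕ, IsUnit (1 - q ^ (n + 1))) (n : ℕ) :
    invPoch (q ^ 2) n = qPoch q (q ^ 2) n * invPoch q (2 * n : ℕ) := by
  have h1 := qPoch_mul_invPoch (isUnit_one_sub_pow_pow hq two_ne_zero) n
  have h2 := qPoch_mul_invPoch hq (2 * n)
  rw [← qPoch_odd_mul_even] at h2
  linear_combination (invPoch q (2 * n : ℕ) * qPoch q (q ^ 2) n) * h1 - invPoch (q ^ 2) n * h2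

/-- The q-Pascal rule, from 1 - q^(M+1) = (1 - q^(M+1-s)) + q^(M+1-s) (1 - q^s). The truncated
exponent is harmless: for `s > M + 1` every term vanishes. -/
theorem one_sub_mul_invPoch_mul_invPoch (hq : ∀ n : ℕ, IsUnit (1 - q ^ (n + 1))) (M s : ℕ) :
    (1 - q ^ (M + 1)) * (invPoch q (M + 1 - s) * invPoch q s) =
      invPoch q (M - s) * invPoch q s +
        q ^ (M + 1 - s) * (invPoch q (M + 1 - s) * invPoch q (s - 1)) := by
  rcases le_or_gt s (M + 1) with h | h
  · have h1 := one_sub_pow_mul_invPoch hq (m := M + 1 - s) (M + 1 - s) (by omega)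
    have h2 := one_sub_pow_mul_invPoch hq (m := s) s rfl
    rw [show (M : ℤ) + 1 - s - 1 = M - s by ring] at h1
    have h3 : q ^ (M + 1) = q ^ (M + 1 - s) * q ^ s := by rw [← pow_add]; congr 1; omega
    rw [← h1, ← h2, h3]
    ring
  · rw [invPoch_of_neg q (m := M + 1 - s) (by omega), invPoch_of_neg q (m := M - s) (by omega)]
    ring

/-- The q-Pascal rule summed against a weight, with `s` shifted by one in the second part. It
supplies the induction steps on `M` in the two summations over a single base. -/
theorem one_sub_mul_sum_invPoch (hq : ∀ n : ℕ, IsUnit (1 - q ^ (n + 1))) (M K : ℕ) (w : ℕ → R) :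
    (1 - q ^ (M + 1)) * ∑ s ∈ Finset.range (K + 1), w s * (invPoch q (M + 1 - s) * invPoch q s) =
      ∑ s ∈ Finset.range (K + 1), w s * (invPoch q (M - s) * invPoch q s) +
        ∑ s ∈ Finset.range K,
          w (s + 1) * q ^ (M - s) * (invPoch q (M - s) * invPoch q s) := by
  have h : ∑ s ∈ Finset.range K, w (s + 1) * q ^ (M - s) * (invPoch q (M - s) * invPoch q s) =
      ∑ s ∈ Finset.range (K + 1),
        w s * (q ^ (M + 1 - s) * (invPoch q (M + 1 - s) * invPoch q (s - 1))) := by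
    rw [Finset.sum_range_succ']
    simp only [Nat.cast_zero, zero_sub, invPoch_of_neg q (show (-1 : ℤ) < 0 by simp), mul_zero,
      add_zero]
    refine Finset.sum_congr rfl fun s _ => ?_
    rw [Nat.add_sub_add_right, show (M : ℤ) + 1 - (s + 1 : ℕ) = M - s by push_cast; ring,
      show ((s + 1 : ℕ) : ℤ) - 1 = s by push_cast; ring]
    ring
  rw [h, Finset.mul_sum, ← Finset.sum_add_distrib]
  refine Finset.sum_congr rfl fun s _ => ?_
  linear_combination w s * one_sub_mul_invPoch_mul_invPoch hq M s

theorem sum_range_eq_zero_term (K : ℕ) (f : ℕ → R) (h : ∀ s, f (s + 1) = 0) :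
    ∑ s ∈ Finset.range (K + 1), f s = f 0 := by
  rw [Finset.sum_range_succ']
  simp [h]

/-- Exponent identities with truncated subtraction need checking only for `t ≤ M`; beyond that the
reciprocal is 0. -/
theorem pow_sub_mul_invPoch (w z : R) (M t : ℕ) (h : t ≤ M → w * q ^ (M - t) = z) :
    w * q ^ (M - t) * invPoch q (M - t) = z * invPoch q (M - t) := by
  rcases le_or_gt t M with h' | h'
  · rw [h h']
  · rw [invPoch_of_neg q (m := M - t) (by omega)]; ring

/-- A finite form of Cauchy's identity (a limiting case of the `q`-Chu–Vandermonde sum). -/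
theorem sum_pow_mul_invPoch (hq : ∀ n : ℕ, IsUnit (1 - q ^ (n + 1))) (M K a : ℕ) (hK : M ≤ K) :
    ∑ s ∈ Finset.range (K + 1),
        q ^ (s * (s + a)) * invPoch q (s + a : ℕ) * (invPoch q (M - s) * invPoch q s) =
      invPoch q M * invPoch q (M + a : ℕ) := by
  induction M generalizing K a with
  | zero =>
    rw [sum_range_eq_zero_term]
    · simp [invPoch_zero]
    · intro s; rw [invPoch_of_neg q (m := (0 : ℕ) - (s + 1 : ℕ)) (by push_cast; omega)]; ring
  | succ M ih =>
    obtain ⟨K, rfl⟩ : ∃ k, K = k + 1 := ⟨K - 1, by omega⟩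
    apply (hq M).mul_left_cancel
    have h := one_sub_mul_sum_invPoch hq M (K + 1)
      (fun s => q ^ (s * (s + a)) * invPoch q (s + a : ℕ))
    rw [ih _ _ (by omega)] at h
    push_cast at h ⊢
    rw [h]
    -- The shifted part is the same sum with `a + 1` for `a` and one term fewer, hence the free `a`
    -- and `K` in the induction.
    have h2 : ∑ s ∈ Finset.range (K + 1), q ^ ((s + 1) * (s + 1 + a)) * invPoch q (s + 1 + a) *
        q ^ (M - s) * (invPoch q (M - s) * invPoch q s) = q ^ (M + 1 + a) *
        (invPoch q M * invPoch q (M + (a + 1) : ℕ)) := by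
      rw [← ih K (a + 1) (by omega), Finset.mul_sum]
      refine Finset.sum_congr rfl fun t _ => ?_
      have := pow_sub_mul_invPoch (q := q) (q ^ ((t + 1) * (t + 1 + a)))
        (q ^ (M + 1 + a) * q ^ (t * (t + (a + 1)))) M t (fun ht => by
          obtain ⟨u, rfl⟩ := Nat.exists_eq_add_of_le ht
          rw [Nat.add_sub_cancel_left]; ring)
      rw [show (t : ℤ) + 1 + a = (t + (a + 1) : ℕ) by push_cast; ring]
      linear_combination (invPoch q (t + (a + 1) : ℕ) * invPoch q t) * this
    rw [h2]
    have h3 := one_sub_pow_mul_invPoch hq (m := M + 1) (M + 1) (by push_cast; ring)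
    have h4 := one_sub_pow_mul_invPoch hq (m := M + 1 + a) (M + 1 + a) (by push_cast; ring)
    rw [show (M : ℤ) + 1 + a - 1 = M + a by ring] at h4
    rw [show (M : ℤ) + 1 - 1 = M by ring] at h3
    rw [← h4, ← h3]
    push_cast
    rw [show (M : ℤ) + (a + 1) = M + 1 + a by ring]
    ring

/-- The `q`-Chu–Vandermonde sum, with denominator parameter a power of `q`. -/
theorem sum_qPoch_mul_invPoch (hq : ∀ n : ℕ, IsUnit (1 - q ^ (n + 1))) (M K a : ℕ) (hK : M ≤ K)
    (b x : R) (hbx : b * x = q ^ (a + 1)) :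
    ∑ s ∈ Finset.range (K + 1), qPoch b q s * (-x) ^ s * q ^ s.choose 2 *
        invPoch q (s + a : ℕ) * (invPoch q (M - s) * invPoch q s) =
      qPoch x q M * (invPoch q M * invPoch q (M + a : ℕ)) := by
  induction M generalizing K a b with
  | zero =>
    rw [sum_range_eq_zero_term]
    · simp [invPoch_zero, qPoch_zero]
    · intro s; rw [invPoch_of_neg q (m := (0 : ℕ) - (s + 1 : ℕ)) (by push_cast; omega)]; ring
  | succ M ih =>
    obtain ⟨K, rfl⟩ : ∃ k, K = k + 1 := ⟨K - 1, by omega⟩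
    apply (hq M).mul_left_cancel
    have h := one_sub_mul_sum_invPoch hq M (K + 1)
      (fun s => qPoch b q s * (-x) ^ s * q ^ s.choose 2 * invPoch q (s + a : ℕ))
    rw [ih _ _ (by omega) b hbx] at h
    push_cast at h ⊢
    rw [h]
    -- Splitting 1 - b off (b;q)_{s+1} replaces `b` by `b * q` and `a` by `a + 1` with `x` fixed,
    -- which preserves `hbx`.
    have h2 : ∑ s ∈ Finset.range (K + 1), qPoch b q (s + 1) * (-x) ^ (s + 1) *
        q ^ (s + 1).choose 2 * invPoch q (s + 1 + a) *
        q ^ (M - s) * (invPoch q (M - s) * invPoch q s) = -((1 - b) * x * q ^ M) *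
        (qPoch x q M * (invPoch q M * invPoch q (M + (a + 1) : ℕ))) := by
      rw [← ih K (a + 1) (by omega) (b * q) (by linear_combination q * hbx), Finset.mul_sum]
      refine Finset.sum_congr rfl fun t _ => ?_
      have := pow_sub_mul_invPoch (q := q) (q ^ ((t + 1).choose 2))
        (q ^ M * q ^ (t.choose 2)) M t (fun ht => by
          obtain ⟨u, rfl⟩ := Nat.exists_eq_add_of_le ht
          rw [Nat.add_sub_cancel_left, Nat.choose_succ_succ' t 1, Nat.choose_one_right]; ring)
      rw [show (t : ℤ) + 1 + a = (t + (a + 1) : ℕ) by push_cast; ring, qPoch_succ']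
      linear_combination ((1 - b) * qPoch (b * q) q t * (-x) ^ (t + 1) *
        invPoch q (t + (a + 1) : ℕ) * invPoch q t) * this
    rw [h2]
    have h3 := one_sub_pow_mul_invPoch hq (m := M + 1) (M + 1) (by push_cast; ring)
    have h4 := one_sub_pow_mul_invPoch hq (m := M + 1 + a) (M + 1 + a) (by push_cast; ring)
    rw [show (M : ℤ) + 1 + a - 1 = M + a by ring] at h4
    rw [show (M : ℤ) + 1 - 1 = M by ring] at h3
    rw [← h4, ← h3, qPoch_succ]
    push_cast
    rw [show (M : ℤ) + (a + 1) = M + 1 + a by ring]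
    -- By `hbx`, (1 - q^(M+1+a)) - (1 - b) x q^M = 1 - x q^M, the new factor of (x;q)_{M+1}.
    linear_combination (qPoch x q M * invPoch q (M + 1 + a) * (1 - q ^ (M + 1)) *
      invPoch q (M + 1) * q ^ M) * hbx

/-- A quadratic analogue of `sum_pow_mul_invPoch`, mixing the bases `q` and `q ^ 2`. -/
theorem sum_pow_mul_invPoch_sq (hq : ∀ n : ℕ, IsUnit (1 - q ^ (n + 1))) (M : ℕ) :
    ∀ K a : ℕ, M ≤ K → ∑ s ∈ Finset.range (K + 1),
        q ^ (2 * (s * (s + a))) * invPoch (q ^ 2) (s + a : ℕ) *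
          (invPoch q (M - 2 * s) * invPoch (q ^ 2) s) =
      qPoch q (q ^ 2) (M + a) * (invPoch q M * invPoch q (M + 2 * a : ℕ)) := by
  have hq2 := isUnit_one_sub_pow_pow hq two_ne_zero
  induction M using Nat.twoStepInduction with
  | zero =>
    intro K a _
    rw [sum_range_eq_zero_term]
    · simp [invPoch_zero, invPoch_sq_eq hq]
    · intro s; rw [invPoch_of_neg q (m := (0 : ℕ) - 2 * (s + 1 : ℕ)) (by push_cast; omega)]; ring
  | one =>
    intro K a _
    rw [sum_range_eq_zero_term]
    · have h1 := invPoch_sq_eq hq a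
      have h4 := one_sub_pow_mul_invPoch hq (m := 1 + 2 * a) (1 + 2 * a) (by push_cast; ring)
      rw [show (1 : ℤ) + 2 * a - 1 = 2 * a by ring] at h4
      rw [add_comm 1 a, qPoch_succ]
      push_cast at h1 ⊢
      simp only [zero_mul, mul_zero, pow_zero, zero_add, invPoch_zero]
      rw [h1, ← h4]
      ring
    · intro s; rw [invPoch_of_neg q (m := (1 : ℕ) - 2 * (s + 1 : ℕ)) (by push_cast; omega)]; ring
  | more M ih0 ih1 =>
    intro K a hK
    obtain ⟨K, rfl⟩ : ∃ k, K = k + 1 := ⟨K - 1, by omega⟩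
    apply (hq (M + 1)).mul_left_cancel
    -- Mixed q-Pascal rule: 1 - q^(M+2) = (1 - q^(M+2-2s)) + q^(M+2-2s) (1 - q^(2s)). Shifting `s`
    -- in the second part lowers the first index by 2, hence the two-step induction.
    have hterm : ∀ s : ℕ, (1 - q ^ (M + 2)) *
        (invPoch q (M + 2 - 2 * s) * invPoch (q ^ 2) s) =
        invPoch q (M + 1 - 2 * s) * invPoch (q ^ 2) s + q ^ (M + 2 - 2 * s) *
          (invPoch q (M + 2 - 2 * s) * invPoch (q ^ 2) (s - 1)) := by
      intro s
      rcases le_or_gt (2 * s) (M + 2) with h | h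
      · have h1 := one_sub_pow_mul_invPoch hq (m := M + 2 - 2 * s) (M + 2 - 2 * s) (by omega)
        have h2 := one_sub_pow_mul_invPoch hq2 (m := s) s rfl
        rw [show (M : ℤ) + 2 - 2 * s - 1 = M + 1 - 2 * s by ring] at h1
        have h3 : q ^ (M + 2) = q ^ (M + 2 - 2 * s) * (q ^ 2) ^ s := by
          rw [← pow_mul, ← pow_add]; congr 1; omega
        rw [← h1, ← h2, h3]
        ring
      · rw [invPoch_of_neg q (m := M + 2 - 2 * s) (by omega),
          invPoch_of_neg q (m := M + 1 - 2 * s) (by omega)]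
        ring
    have h2 : ∑ s ∈ Finset.range (K + 1 + 1), q ^ (2 * (s * (s + a))) *
        invPoch (q ^ 2) (s + a : ℕ) * (q ^ (M + 2 - 2 * s) *
          (invPoch q (M + 2 - 2 * s) * invPoch (q ^ 2) (s - 1))) = q ^ (M + 2 + 2 * a) *
        (qPoch q (q ^ 2) (M + (a + 1)) *
          (invPoch q M * invPoch q (M + 2 * (a + 1) : ℕ))) := by
      rw [← ih0 K (a + 1) (by omega), Finset.mul_sum, Finset.sum_range_succ']
      simp only [Nat.cast_zero, zero_sub, invPoch_of_neg (q ^ 2) (show (-1 : ℤ) < 0 by simp),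
        mul_zero, add_zero]
      refine Finset.sum_congr rfl fun t _ => ?_
      rw [show (M : ℤ) + 2 - 2 * (t + 1 : ℕ) = M - 2 * t by push_cast; ring,
        show ((t + 1 : ℕ) : ℤ) - 1 = t by push_cast; ring, show t + 1 + a = t + (a + 1) by ring,
        show M + 2 - 2 * (t + 1) = M - 2 * t by omega]
      have := pow_sub_mul_invPoch (q := q) (q ^ (2 * ((t + 1) * (t + (a + 1)))))
        (q ^ (M + 2 + 2 * a) * q ^ (2 * (t * (t + (a + 1))))) M (2 * t) (fun ht => by
          obtain ⟨u, rfl⟩ := Nat.exists_eq_add_of_le ht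
          rw [Nat.add_sub_cancel_left]; ring)
      push_cast at this ⊢
      linear_combination (invPoch (q ^ 2) (t + (a + 1)) * invPoch (q ^ 2) t) * this
    have h := ih1 (K + 1) a (by omega)
    have h3 := one_sub_pow_mul_invPoch hq (m := M + 1) (M + 1) (by push_cast; ring)
    have h4 := one_sub_pow_mul_invPoch hq (m := M + 2 + 2 * a) (M + 2 + 2 * a) (by push_cast; ring)
    have h5 := one_sub_pow_mul_invPoch hq (m := M + 2) (M + 2) (by push_cast; ring)
    rw [show (M : ℤ) + 2 + 2 * a - 1 = M + 1 + 2 * a by ring] at h4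
    rw [show (M : ℤ) + 1 - 1 = M by ring] at h3
    rw [show (M : ℤ) + 2 - 1 = M + 1 by ring] at h5
    push_cast at h h2 ⊢
    have key : (1 - q ^ (M + 1 + 1)) * ∑ s ∈ Finset.range (K + 1 + 1),
        q ^ (2 * (s * (s + a))) * invPoch (q ^ 2) (s + a) *
          (invPoch q (M + 2 - 2 * s) * invPoch (q ^ 2) s) =
        qPoch q (q ^ 2) (M + 1 + a) * (invPoch q (M + 1) * invPoch q (M + 1 + 2 * a)) +
        q ^ (M + 2 + 2 * a) * (qPoch q (q ^ 2) (M + (a + 1)) *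
          (invPoch q M * invPoch q (M + 2 * (a + 1)))) := by
      rw [← h, ← h2, Finset.mul_sum, ← Finset.sum_add_distrib]
      refine Finset.sum_congr rfl fun s _ => ?_
      linear_combination (q ^ (2 * (s * (s + a))) * invPoch (q ^ 2) (s + a)) * hterm s
    -- The two parts combine through 1 - q^(M+2+2a) + q^(M+2+2a) (1 - q^(M+1)) = 1 - q^(2M+2a+3),
    -- the next factor of (q;q²)_{M+2+a}.
    rw [key, show M + (a + 1) = M + 1 + a by ring, show M + 2 + a = M + 1 + a + 1 by ring,
      qPoch_succ, ← h3, ← h4, ← h5, show (M : ℤ) + 2 * (a + 1) = M + 2 + 2 * a by ring]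
    ring

end Finite

/-! ### Bailey pairs relative to 1 and the Bailey chains -/

section Bailey

variable {R : Type*} [CommRing R]

/-- The `β`-side of a Bailey pair relative to `1` whose `α`-side is `α j` at the index `d * j` and
`0` at the indices that are not multiples of `d`. -/
noncomputable def baileySum (d : ℕ) (q : R) (α : ℕ → R) (n : ℕ) : R :=
  ∑ j ∈ Finset.range (n + 1), α j * (invPoch q (n - (d * j : ℕ)) * invPoch q (n + (d * j : ℕ)))

theorem baileySum_eq_sum_range {d : ℕ} (hd : d ≠ 0) (q : R) (α : ℕ → R) {n N : ℕ} (h : n ≤ N) :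
    baileySum d q α n = ∑ j ∈ Finset.range (N + 1),
      α j * (invPoch q (n - (d * j : ℕ)) * invPoch q (n + (d * j : ℕ))) := by
  refine Finset.sum_subset (Finset.range_mono (by omega)) fun j _ hj => ?_
  have h1 : n < j := by simpa using hj
  have h2 : j ≤ d * j := Nat.le_mul_of_pos_left j (by omega)
  rw [invPoch_of_neg q (m := n - (d * j : ℕ)) (by omega)]
  ring

theorem baileySum_congr {d : ℕ} {q : R} {α α' : ℕ → R} (h : ∀ j, α j = α' j) (n : ℕ) :
    baileySum d q α n = baileySum d q α' n := by
  rw [funext h]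

/-- Bailey's transform: after interchanging the sums, a move on pairs reduces to the evaluation `h`
of one inner sum. The factor `e` stretches the indices when the base changes from `p` to `q`. -/
theorem sum_mul_baileySum {d e : ℕ} (hd : d ≠ 0) (q p : R) (α C w : ℕ → R) (n : ℕ)
    (h : ∀ k : ℕ, ∑ r ∈ Finset.range (n + 1), w r * (invPoch p (r - k) * invPoch p (r + k)) =
      C k * (invPoch q (n - (e * k : ℕ)) * invPoch q (n + (e * k : ℕ)))) :
    ∑ r ∈ Finset.range (n + 1), w r * baileySum d p α r =
      baileySum (e * d) q (fun j => C (d * j) * α j) n := by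
  have h1 : ∀ r ∈ Finset.range (n + 1), w r * baileySum d p α r =
      ∑ j ∈ Finset.range (n + 1),
        α j * (w r * (invPoch p (r - (d * j : ℕ)) * invPoch p (r + (d * j : ℕ)))) := by
    intro r hr
    rw [baileySum_eq_sum_range hd p α (Nat.lt_succ_iff.mp (Finset.mem_range.mp hr)),
      Finset.mul_sum]
    exact Finset.sum_congr rfl fun j _ => by ring
  rw [Finset.sum_congr rfl h1, Finset.sum_comm, baileySum]
  refine Finset.sum_congr rfl fun j _ => ?_
  rw [← Finset.mul_sum, h, mul_assoc e d j]
  ring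

theorem sum_range_shift {n k : ℕ} (h : k ≤ n) (f : ℕ → R) (h0 : ∀ r < k, f r = 0) :
    ∑ r ∈ Finset.range (n + 1), f r = ∑ s ∈ Finset.range (n - k + 1), f (k + s) := by
  rw [show n + 1 = k + (n - k + 1) by omega, Finset.sum_range_add,
    Finset.sum_eq_zero fun r hr => h0 r (Finset.mem_range.mp hr), zero_add]

variable {q : R}

/-- Bailey's lemma with both parameters tending to infinity. -/
theorem sum_pow_sq_mul_baileySum (hq : ∀ n : ℕ, IsUnit (1 - q ^ (n + 1))) {d : ℕ} (hd : d ≠ 0)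
    (α : ℕ → R) (n : ℕ) :
    ∑ r ∈ Finset.range (n + 1), q ^ r ^ 2 * invPoch q (n - r) * baileySum d q α r =
      baileySum d q (fun j => q ^ (d * j) ^ 2 * α j) n := by
  have := sum_mul_baileySum (e := 1) hd q q α (fun k => q ^ k ^ 2)
    (fun r => q ^ r ^ 2 * invPoch q (n - r)) n ?_
  · simpa using this
  intro k
  rw [one_mul]
  rcases le_or_gt k n with h | h
  · rw [sum_range_shift h]
    · obtain ⟨M, rfl⟩ := Nat.exists_eq_add_of_le h
      -- With r = k + s, r² = k² + s(s + 2k), so the parameter is a = 2k.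
      have := sum_pow_mul_invPoch hq M M (2 * k) le_rfl
      rw [Nat.add_sub_cancel_left, show ((k + M : ℕ) : ℤ) - k = M by push_cast; ring,
        show ((k + M : ℕ) : ℤ) + k = (M + 2 * k : ℕ) by push_cast; ring, ← this, Finset.mul_sum]
      refine Finset.sum_congr rfl fun s _ => ?_
      rw [show ((k + M : ℕ) : ℤ) - (k + s : ℕ) = M - s by push_cast; ring,
        show ((k + s : ℕ) : ℤ) - k = s by push_cast; ring,
        show ((k + s : ℕ) : ℤ) + k = (s + 2 * k : ℕ) by push_cast; ring]
      ring
    · intro r hr; rw [invPoch_of_neg q (m := r - k) (by omega)]; ring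
  · rw [invPoch_of_neg q (m := n - k) (by omega), zero_mul, mul_zero]
    refine Finset.sum_eq_zero fun r hr => ?_
    rw [Finset.mem_range] at hr
    rw [invPoch_of_neg q (m := r - k) (by omega)]; ring

/-- A change of base in Bailey pairs, from `q ^ 2` to `q`. -/
theorem sum_pow_sq_mul_baileySum_sq (hq : ∀ n : ℕ, IsUnit (1 - q ^ (n + 1))) {d : ℕ} (hd : d ≠ 0)
    (α : ℕ → R) (n : ℕ) :
    ∑ r ∈ Finset.range (n + 1),
        q ^ (2 * r ^ 2) * invPoch q (n - (2 * r : ℕ)) * baileySum d (q ^ 2) α r =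
      qPoch q (q ^ 2) n * baileySum (2 * d) q (fun j => q ^ (2 * (d * j) ^ 2) * α j) n := by
  have := sum_mul_baileySum (e := 2) hd q (q ^ 2) α (fun k => qPoch q (q ^ 2) n * q ^ (2 * k ^ 2))
    (fun r => q ^ (2 * r ^ 2) * invPoch q (n - (2 * r : ℕ))) n ?_
  · rw [this, baileySum, baileySum, Finset.mul_sum]
    exact Finset.sum_congr rfl fun j _ => by ring
  intro k
  rcases le_or_gt (2 * k) n with h | h
  · rw [sum_range_shift (k := k) (by omega)]
    · obtain ⟨M, rfl⟩ := Nat.exists_eq_add_of_le h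
      -- Here n = 2k + M and r = k + s, so `s` runs up to M + k although its terms vanish once 2s >
      -- M.
      have := sum_pow_mul_invPoch_sq hq M (M + k) (2 * k) (by omega)
      rw [show 2 * k + M - k = M + k by omega,
        show ((2 * k + M : ℕ) : ℤ) - (2 * k : ℕ) = M by push_cast; ring,
        show ((2 * k + M : ℕ) : ℤ) + (2 * k : ℕ) = (M + 2 * (2 * k) : ℕ) by push_cast; ring,
        mul_right_comm, show 2 * k + M = M + 2 * k by ring, ← this, Finset.sum_mul]
      refine Finset.sum_congr rfl fun s _ => ?_
      rw [show ((M + 2 * k : ℕ) : ℤ) - (2 * (k + s) : ℕ) = M - 2 * s by push_cast; ring,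
        show ((k + s : ℕ) : ℤ) - k = s by push_cast; ring,
        show ((k + s : ℕ) : ℤ) + k = (s + 2 * k : ℕ) by push_cast; ring]
      ring
    · intro r hr; rw [invPoch_of_neg (q ^ 2) (m := r - k) (by omega)]; ring
  · rw [invPoch_of_neg q (m := n - (2 * k : ℕ)) (by omega), zero_mul, mul_zero]
    refine Finset.sum_eq_zero fun r hr => ?_
    rcases le_or_gt k r with h' | h'
    · rw [invPoch_of_neg q (m := n - (2 * r : ℕ)) (by omega)]; ring
    · rw [invPoch_of_neg (q ^ 2) (m := r - k) (by omega)]; ring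

/-- The factor that the index `k` acquires in Bailey's lemma with parameters `-1` and `∞`. -/
noncomputable def baileyFactor (q : R) (k : ℕ) : R :=
  qPoch (-1) q k * Ring.inverse (qPoch (-q) q k) * q ^ (k + 1).choose 2

theorem baileyFactor_zero (q : R) : baileyFactor q 0 = 1 := by simp [baileyFactor, qPoch_zero]

/-- The quotient telescopes: (-1;q)_k = 2 (-q;q)_{k-1} for k ≥ 1. -/
theorem one_add_pow_mul_baileyFactor (hq : ∀ n : ℕ, IsUnit (1 - q ^ (n + 1))) {k : ℕ}
    (hk : k ≠ 0) : (1 + q ^ k) * baileyFactor q k = 2 * q ^ (k + 1).choose 2 := by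
  obtain ⟨k, rfl⟩ := Nat.exists_eq_succ_of_ne_zero hk
  have h := Ring.mul_inverse_cancel _ (isUnit_qPoch_neg hq (k + 1))
  rw [baileyFactor, Nat.succ_eq_add_one, qPoch_succ', neg_one_mul]
  generalize Ring.inverse (qPoch (-q) q (k + 1)) = u at h ⊢
  rw [qPoch_succ] at h
  linear_combination (2 * q ^ (k + 1 + 1).choose 2) * h

/-- The finite form of Bailey's lemma with parameters `-1` and `∞`. -/
theorem sum_qPoch_neg_one_mul_baileySum (hq : ∀ n : ℕ, IsUnit (1 - q ^ (n + 1))) {d : ℕ}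
    (hd : d ≠ 0) (α : ℕ → R) (n : ℕ) :
    ∑ r ∈ Finset.range (n + 1),
        qPoch (-1) q r * q ^ (r + 1).choose 2 * invPoch q (n - r) * baileySum d q α r =
      qPoch (-q) q n * baileySum d q (fun j => baileyFactor q (d * j) * α j) n := by
  have := sum_mul_baileySum (e := 1) hd q q α (fun k => qPoch (-q) q n * baileyFactor q k)
    (fun r => qPoch (-1) q r * q ^ (r + 1).choose 2 * invPoch q (n - r)) n ?_
  · rw [this, one_mul, baileySum, baileySum, Finset.mul_sum]
    exact Finset.sum_congr rfl fun j _ => by ring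
  intro k
  rw [one_mul]
  rcases le_or_gt k n with h | h
  · rw [sum_range_shift h]
    · obtain ⟨M, rfl⟩ := Nat.exists_eq_add_of_le h
      -- The parameters come from (-1;q)_{k+s} = (-1;q)_k (-q^k;q)_s and (-q;q)_{k+M} = (-q;q)_k
      -- (-q^(k+1);q)_M; their product is q^(2k+1).
      have := sum_qPoch_mul_invPoch hq M M (2 * k) le_rfl (-q ^ k) (-q ^ (k + 1)) (by ring)
      have hu := Ring.mul_inverse_cancel _ (isUnit_qPoch_neg hq k)
      rw [Nat.add_sub_cancel_left, show ((k + M : ℕ) : ℤ) - k = M by push_cast; ring,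
        show ((k + M : ℕ) : ℤ) + k = (M + 2 * k : ℕ) by push_cast; ring, qPoch_add, baileyFactor,
        show -q * q ^ k = -q ^ (k + 1) by ring]
      calc _ = (qPoch (-1) q k * q ^ (k + 1).choose 2) * ∑ s ∈ Finset.range (M + 1),
            qPoch (-q ^ k) q s * (- -q ^ (k + 1)) ^ s * q ^ s.choose 2 *
              invPoch q (s + 2 * k : ℕ) * (invPoch q (M - s) * invPoch q s) := by
            rw [Finset.mul_sum]
            refine Finset.sum_congr rfl fun s _ => ?_
            have hc : q ^ (k + s + 1).choose 2 =
                q ^ (k + 1).choose 2 * ((q ^ (k + 1)) ^ s * q ^ s.choose 2) := by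
              rw [← pow_mul, ← pow_add, ← pow_add]
              congr 1
              clear * -
              induction s with
              | zero => simp
              | succ s ih =>
                rw [show k + (s + 1) + 1 = (k + s + 1) + 1 by ring, Nat.choose_succ_succ' _ 1,
                  Nat.choose_succ_succ' s 1, ih, Nat.choose_one_right, Nat.choose_one_right]
                ring
            rw [show ((k + M : ℕ) : ℤ) - (k + s : ℕ) = M - s by push_cast; ring,
              show ((k + s : ℕ) : ℤ) - k = s by push_cast; ring,
              show ((k + s : ℕ) : ℤ) + k = (s + 2 * k : ℕ) by push_cast; ring, hc, qPoch_add,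
              neg_one_mul, neg_neg]
            ring
        _ = _ := by
            rw [this]
            linear_combination (-(qPoch (-1) q k * q ^ (k + 1).choose 2 *
              qPoch (-q ^ (k + 1)) q M * invPoch q M * invPoch q (M + 2 * k : ℕ))) * hu
    · intro r hr; rw [invPoch_of_neg q (m := r - k) (by omega)]; ring
  · rw [invPoch_of_neg q (m := n - k) (by omega), zero_mul, mul_zero]
    refine Finset.sum_eq_zero fun r hr => ?_
    rw [Finset.mem_range] at hr
    rw [invPoch_of_neg q (m := r - k) (by omega)]; ring

/-- The `α`-side of the unit Bailey pair relative to `1`. -/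
def unitAlpha (q : R) (j : ℕ) : R :=
  if j = 0 then 1 else (-1) ^ j * q ^ j.choose 2 * (1 + q ^ j)

theorem baileySum_unitAlpha (hq : ∀ n : ℕ, IsUnit (1 - q ^ (n + 1))) (n : ℕ) :
    baileySum 1 q (unitAlpha q) n = if n = 0 then 1 else 0 := by
  split_ifs with hn
  · subst hn; simp [baileySum, unitAlpha, invPoch_zero]
  -- The partial sums telescope to a closed form, which at `J = n` contains the reciprocal at index
  -- -1, that is 0.
  have key : ∀ J ≤ n, (1 - q ^ n) * ∑ j ∈ Finset.range (J + 1),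
      unitAlpha q j * (invPoch q (n - j) * invPoch q (n + j)) =
      (-1) ^ J * q ^ (J + 1).choose 2 * (invPoch q (n - J - 1) * invPoch q (n + J)) := by
    intro J hJ
    induction J with
    | zero =>
      have := one_sub_pow_mul_invPoch hq (m := n) n rfl
      simp only [zero_add, Finset.range_one, Finset.sum_singleton, unitAlpha, if_true,
        Nat.cast_zero, sub_zero, add_zero, Nat.choose_eq_zero_of_lt one_lt_two]
      linear_combination invPoch q n * this
    | succ J ih =>
      have h1 := one_sub_pow_mul_invPoch hq (m := n - J - 1) (n - (J + 1)) (by omega)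
      have h2 := one_sub_pow_mul_invPoch hq (m := n + J + 1) (n + J + 1) (by push_cast; ring)
      have h3 : q ^ (J + 1) * q ^ (n - (J + 1)) = q ^ n := by rw [← pow_add]; congr 1; omega
      rw [show (n : ℤ) + J + 1 - 1 = n + J by ring] at h2
      rw [Finset.sum_range_succ, mul_add, ih (by omega), unitAlpha, if_neg (by omega),
        Nat.choose_succ_succ' (J + 1) 1, Nat.choose_one_right, ← h2]
      push_cast
      rw [show (n : ℤ) - (J + 1) = n - J - 1 by ring, ← h1,
        show (n : ℤ) + (J + 1) = n + J + 1 by ring, ← h3]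
      rw [show q ^ (n + J + 1) = q ^ n * q ^ (J + 1) by ring, ← h3]
      ring
  apply (isUnit_one_sub_pow hq hn).mul_left_cancel
  have := key n le_rfl
  rw [invPoch_of_neg q (m := n - n - 1) (by omega)] at this
  simp only [baileySum, one_mul]
  rw [this]
  ring

/-- The coefficients of the theta series `1 + 2 ∑_{j ≥ 1} (-1) ^ j x ^ j ^ 2`. -/
def thetaTerm (x : R) (j : ℕ) : R := if j = 0 then 1 else 2 * (-1) ^ j * x ^ j ^ 2

theorem two_mul_choose_two (k : ℕ) : 2 * (k + 1).choose 2 = k * (k + 1) := by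
  induction k with
  | zero => rfl
  | succ k ih => rw [Nat.choose_succ_succ' _ 1, mul_add, ih, Nat.choose_one_right]; ring

/-- The factor 1 + q^(dj) cancels. In the exponent, dj(dj+1)/2 + e j² + d j(j-1)/2 has no linear
term and equals m j² by `h`. -/
theorem baileyFactor_mul_unitAlpha (hq : ∀ n : ℕ, IsUnit (1 - q ^ (n + 1))) {d e m : ℕ} (hd : d ≠ 0)
    (h : d ^ 2 + d + 2 * e = 2 * m) (j : ℕ) :
    baileyFactor q (d * j) * (q ^ (e * j ^ 2) * unitAlpha (q ^ d) j) = thetaTerm (q ^ m) j := by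
  rcases Nat.eq_zero_or_eq_succ_pred j with rfl | hj
  · simp [baileyFactor_zero, unitAlpha, thetaTerm]
  · generalize j.pred = i at hj
    subst hj
    have h1 := one_add_pow_mul_baileyFactor hq (k := d * (i + 1)) (by positivity)
    have h2 : q ^ (d * (i + 1) + 1).choose 2 * (q ^ (e * (i + 1) ^ 2) * (q ^ d) ^ (i + 1).choose 2) =
        (q ^ m) ^ (i + 1) ^ 2 := by
      rw [← pow_mul, ← pow_mul, ← pow_add, ← pow_add]
      congr 1
      have h3 := two_mul_choose_two (d * (i + 1))
      have h4 := two_mul_choose_two i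
      apply Nat.eq_of_mul_eq_mul_left two_pos
      rw [← mul_assoc 2 m, ← h]
      linear_combination h3 + d * h4
    rw [unitAlpha, thetaTerm, Nat.succ_eq_add_one, if_neg (by simp), if_neg (by simp), ← h2,
      ← pow_mul q d (i + 1)]
    linear_combination ((-1) ^ (i + 1) * q ^ (e * (i + 1) ^ 2) * (q ^ d) ^ (i + 1).choose 2) * h1

/-- The change of base applied to the unit pair in base q²; only r = 0 survives on the β-side. -/
theorem baileySum_two_unitAlpha (hq : ∀ n : ℕ, IsUnit (1 - q ^ (n + 1))) (n : ℕ) :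
    baileySum 2 q (fun j => q ^ (2 * j ^ 2) * unitAlpha (q ^ 2) j) n =
      invPoch q n * Ring.inverse (qPoch q (q ^ 2) n) := by
  have h := sum_pow_sq_mul_baileySum_sq hq one_ne_zero (unitAlpha (q ^ 2)) n
  simp only [baileySum_unitAlpha (isUnit_one_sub_pow_pow hq two_ne_zero), mul_ite, mul_one,
    mul_zero, Finset.sum_ite_eq', Finset.mem_range, Nat.succ_pos, if_true, one_mul] at h
  apply (isUnit_qPoch_odd hq n).mul_left_cancel
  rw [← h, mul_left_comm, Ring.mul_inverse_cancel _ (isUnit_qPoch_odd hq n)]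
  simp

/-- The shortest chain: parameters -1 and ∞ applied to the unit pair. Its limit is Gauss's product
for the theta series. -/
theorem sum_baileySum_thetaTerm_one (hq : ∀ n : ℕ, IsUnit (1 - q ^ (n + 1))) (L : ℕ) :
    invPoch q L = qPoch (-q) q L * baileySum 1 q (thetaTerm q) L := by
  have h := sum_qPoch_neg_one_mul_baileySum hq one_ne_zero (unitAlpha q) L
  simp only [baileySum_unitAlpha hq, mul_ite, mul_one,
    mul_zero, Finset.sum_ite_eq', Finset.mem_range, Nat.succ_pos, if_true] at h
  rw [← baileySum_congr (α := fun j => baileyFactor q (1 * j) * unitAlpha q j), ← h]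
  · simp [qPoch_zero]
  · intro j
    simpa using baileyFactor_mul_unitAlpha hq (e := 0) (m := 1) one_ne_zero rfl j

theorem sum_baileySum_thetaTerm_nine (hq : ∀ n : ℕ, IsUnit (1 - q ^ (n + 1))) (L : ℕ) :
    ∑ N ∈ Finset.range (L + 1), invPoch q (L - N) * ∑ r ∈ Finset.range (N + 1),
        qPoch (-1) q N * q ^ (N + 1).choose 2 * (q ^ r ^ 2 * invPoch q (N - r) *
          (invPoch q r * Ring.inverse (qPoch q (q ^ 2) r))) =
      qPoch (-q) q L * baileySum 2 q (thetaTerm (q ^ 9)) L := by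
  have h := sum_qPoch_neg_one_mul_baileySum hq two_ne_zero
    (fun j => q ^ (2 * j) ^ 2 * (q ^ (2 * j ^ 2) * unitAlpha (q ^ 2) j)) L
  rw [baileySum_congr (α' := thetaTerm (q ^ 9))] at h
  · rw [← h]
    refine Finset.sum_congr rfl fun N _ => ?_
    rw [← sum_pow_sq_mul_baileySum hq two_ne_zero, ← Finset.mul_sum]
    simp only [baileySum_two_unitAlpha hq]
    ring
  · intro j
    -- 6 = 4 + 2: q^((2j)²) from Bailey's lemma and q^(2j²) from the change of base. Then 9 = (2² +
    -- 2 + 2·6)/2.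
    rw [← baileyFactor_mul_unitAlpha hq (e := 6) (m := 9) two_ne_zero rfl j]
    ring

theorem sum_baileySum_thetaTerm_twentyTwo (hq : ∀ n : ℕ, IsUnit (1 - q ^ (n + 1))) (L : ℕ) :
    ∑ N ∈ Finset.range (L + 1), invPoch q (L - N) * ∑ r ∈ Finset.range (N + 1),
        qPoch (-1) q N * q ^ (N + 1).choose 2 * Ring.inverse (qPoch q (q ^ 2) N) *
          (q ^ (2 * r ^ 2) * invPoch q (N - (2 * r : ℕ)) *
            (invPoch (q ^ 2) r * Ring.inverse (qPoch (q ^ 2) ((q ^ 2) ^ 2) r))) =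
      qPoch (-q) q L * baileySum 4 q (thetaTerm (q ^ 22)) L := by
  have h := sum_qPoch_neg_one_mul_baileySum hq four_ne_zero
    (fun j => q ^ (2 * (2 * j) ^ 2) * ((q ^ 2) ^ (2 * j ^ 2) * unitAlpha ((q ^ 2) ^ 2) j)) L
  rw [baileySum_congr (α' := thetaTerm (q ^ 22))] at h
  · rw [← h]
    refine Finset.sum_congr rfl fun N _ => ?_
    have h1 := sum_pow_sq_mul_baileySum_sq hq two_ne_zero
      (fun j => (q ^ 2) ^ (2 * j ^ 2) * unitAlpha ((q ^ 2) ^ 2) j) N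
    simp only [baileySum_two_unitAlpha (isUnit_one_sub_pow_pow hq two_ne_zero)] at h1
    rw [← Finset.mul_sum, h1]
    have h2 := Ring.mul_inverse_cancel _ (isUnit_qPoch_odd hq N)
    norm_num only
    linear_combination (invPoch q (L - N) * qPoch (-1) q N * q ^ (N + 1).choose 2 *
      baileySum 4 q (fun j => q ^ (2 * (2 * j) ^ 2) *
        ((q ^ 2) ^ (2 * j ^ 2) * unitAlpha ((q ^ 2) ^ 2) j)) N) * h2
  · intro j
    -- 12 = 8 + 4, from the two changes of base. Then 22 = (4² + 4 + 2·12)/2.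
    rw [← baileyFactor_mul_unitAlpha hq (e := 12) (m := 22) four_ne_zero rfl j, ← pow_mul q 2 2]
    ring

end Bailey

/-! ### Passage to the limit in a complete normed ring -/

section Limits

open Filter Topology

theorem exists_norm_le_of_tendsto {R : Type*} [NormedCommRing R] {f : ℕ → R} {y : R}
    (h : Tendsto f atTop (𝓝 y)) : ∃ C, 0 ≤ C ∧ ∀ n, ‖f n‖ ≤ C := by
  obtain ⟨C, hC⟩ := h.norm.bddAbove_range
  exact ⟨C, (norm_nonneg _).trans (hC ⟨0, rfl⟩), fun n => hC ⟨n, rfl⟩⟩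

variable {R : Type*} [NormedCommRing R] [NormOneClass R] {q : R}

theorem norm_pow_lt_one (hq : ‖q‖ < 1) {n : ℕ} (hn : n ≠ 0) : ‖q ^ n‖ < 1 :=
  (norm_pow_le q n).trans_lt (pow_lt_one₀ (norm_nonneg q) hq hn)

theorem norm_thetaTerm_le {x : R} (hx : ‖x‖ < 1) (j : ℕ) : ‖thetaTerm x j‖ ≤ 2 * ‖x‖ ^ j := by
  rcases eq_or_ne j 0 with rfl | hj
  · simp [thetaTerm]
  · have h2 : ‖(2 : R)‖ ≤ 2 := by
      rw [← one_add_one_eq_two]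
      exact (norm_add_le _ _).trans (by rw [norm_one]; norm_num)
    have h3 : ‖(2 * (-1) ^ j : R)‖ ≤ 2 := by
      rcases neg_one_pow_eq_or R j with h | h <;> simpa [h] using h2
    rw [thetaTerm, if_neg hj]
    refine (norm_mul_le _ _).trans (mul_le_mul h3 ?_ (norm_nonneg _) (by norm_num))
    exact (norm_pow_le _ _).trans
      (pow_le_pow_of_le_one (norm_nonneg x) hx.le (Nat.le_self_pow two_ne_zero j))

theorem summable_norm_thetaTerm {x : R} (hx : ‖x‖ < 1) : Summable fun j => ‖thetaTerm x j‖ :=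
  Summable.of_nonneg_of_le (fun _ => norm_nonneg _) (norm_thetaTerm_le hx)
    ((summable_geometric_of_lt_one (norm_nonneg x) hx).mul_left 2)

theorem summable_norm_pow_mul (hq : ‖q‖ < 1) (e : ℕ → ℕ → ℕ) (he : ∀ N r, N + r ≤ e N r)
    (A : ℕ → ℕ → R) {C : ℝ} (hA : ∀ N r, ‖A N r‖ ≤ C) :
    Summable fun p : ℕ × ℕ => ‖q ^ e p.1 p.2 * A p.1 p.2‖ := by
  have hg := summable_geometric_of_lt_one (norm_nonneg q) hq
  have h := (hg.mul_of_nonneg hg (fun n => by positivity) (fun n => by positivity)).mul_right C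
  refine Summable.of_nonneg_of_le (fun _ => norm_nonneg _) (fun p => ?_) h
  rw [← pow_add]
  refine (norm_mul_le _ _).trans (mul_le_mul ?_ (hA _ _) (norm_nonneg _) (by positivity))
  exact (norm_pow_le _ _).trans (pow_le_pow_of_le_one (norm_nonneg q) hq.le (he _ _))

variable [CompleteSpace R]

theorem isUnit_one_sub_pow_succ (hq : ‖q‖ < 1) (n : ℕ) : IsUnit (1 - q ^ (n + 1)) :=
  isUnit_one_sub_of_norm_lt_one (norm_pow_lt_one hq n.succ_ne_zero)

theorem multipliable_one_sub_mul_pow (a : R) (hq : ‖q‖ < 1) :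
    Multipliable fun j : ℕ => 1 - a * q ^ j := by
  have h : Summable fun j : ℕ => ‖-(a * q ^ j)‖ := by
    refine Summable.of_nonneg_of_le (fun _ => norm_nonneg _) (fun j => ?_)
      ((summable_geometric_of_lt_one (norm_nonneg q) hq).mul_left ‖a‖)
    rw [norm_neg]
    exact (norm_mul_le _ _).trans (mul_le_mul_of_nonneg_left (norm_pow_le _ _) (norm_nonneg _))
  simpa [sub_eq_add_neg] using multipliable_one_add_of_summable h

theorem tendsto_qPoch (a : R) (hq : ‖q‖ < 1) :
    Tendsto (qPoch a q) atTop (𝓝 (qPochInf a q)) :=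
  (multipliable_one_sub_mul_pow a hq).hasProd.tendsto_prod_nat

/-- The inverted factors 1 + y_j themselves form a convergent product: y_j = q^(j+1) (1 + y_j)
bounds y_j geometrically. No multiplicativity of the norm is needed, and invertibility of (q;q)_∞
follows. -/
theorem exists_tendsto_invPoch (hq : ‖q‖ < 1) :
    ∃ y, Tendsto (fun n : ℕ => invPoch q n) atTop (𝓝 y) := by
  have hu := isUnit_one_sub_pow_succ hq
  set y : ℕ → R := fun j => Ring.inverse (1 - q ^ (j + 1)) - 1 with hy
  have hy' : ∀ j, y j = q ^ (j + 1) * (1 + y j) := by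
    intro j
    have := Ring.mul_inverse_cancel _ (hu j)
    simp only [hy]
    linear_combination this
  have hb : ∀ j, ‖y j‖ ≤ ‖q‖ ^ j * (1 - ‖q‖)⁻¹ := by
    intro j
    have h1 : ‖y j‖ ≤ ‖q‖ ^ (j + 1) * (1 + ‖y j‖) := by
      conv_lhs => rw [hy' j]
      refine (norm_mul_le _ _).trans (mul_le_mul (norm_pow_le _ _) ?_ (norm_nonneg _)
        (by positivity))
      exact (norm_add_le _ _).trans (by rw [norm_one])
    have h2 : ‖q‖ ^ (j + 1) ≤ ‖q‖ := pow_le_of_le_one (norm_nonneg _) hq.le (by simp)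
    have h3 : ‖q‖ ^ (j + 1) ≤ ‖q‖ ^ j := pow_le_pow_of_le_one (norm_nonneg _) hq.le (by simp)
    rw [← div_eq_mul_inv, le_div_iff₀ (by linarith)]
    nlinarith [norm_nonneg (y j)]
  have hm : Multipliable fun j => 1 + y j := multipliable_one_add_of_summable
    (Summable.of_nonneg_of_le (fun _ => norm_nonneg _) hb
      ((summable_geometric_of_lt_one (norm_nonneg q) hq).mul_right _))
  refine ⟨_, hm.hasProd.tendsto_prod_nat.congr fun n => ?_⟩
  induction n with
  | zero => simp [invPoch_zero]
  | succ n ih =>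
    rw [Finset.prod_range_succ, ih]
    have := one_sub_pow_mul_invPoch hu (m := (n + 1 : ℕ)) (n + 1) rfl
    rw [show ((n + 1 : ℕ) : ℤ) - 1 = n by push_cast; ring] at this
    have h2 := Ring.mul_inverse_cancel _ (hu n)
    rw [← this]
    simp only [hy]
    linear_combination invPoch q (n + 1 : ℕ) * h2

theorem isUnit_qPochInf_and_tendsto_invPoch (hq : ‖q‖ < 1) : IsUnit (qPochInf q q) ∧
    Tendsto (fun n : ℕ => invPoch q n) atTop (𝓝 (Ring.inverse (qPochInf q q))) := by
  obtain ⟨y, hy⟩ := exists_tendsto_invPoch hq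
  have h1 : qPochInf q q * y = 1 := by
    refine tendsto_nhds_unique ((tendsto_qPoch q hq).mul hy) ?_
    simp only [qPoch_mul_invPoch (isUnit_one_sub_pow_succ hq)]
    exact tendsto_const_nhds
  have hu := IsUnit.of_mul_eq_one _ h1
  refine ⟨hu, ?_⟩
  rwa [show Ring.inverse (qPochInf q q) = y from hu.mul_left_cancel
    (by rw [Ring.mul_inverse_cancel _ hu, h1])]

theorem isUnit_qPochInf (hq : ‖q‖ < 1) : IsUnit (qPochInf q q) :=
  (isUnit_qPochInf_and_tendsto_invPoch hq).1

theorem tendsto_invPoch (hq : ‖q‖ < 1) {f : ℕ → ℤ} (hf : Tendsto f atTop atTop) :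
    Tendsto (fun n => invPoch q (f n)) atTop (𝓝 (Ring.inverse (qPochInf q q))) := by
  have h : Tendsto (fun n => (f n).toNat) atTop atTop :=
    tendsto_atTop.mpr fun b => (tendsto_atTop.mp hf b).mono fun n hn => by omega
  refine ((isUnit_qPochInf_and_tendsto_invPoch hq).2.comp h).congr' ?_
  filter_upwards [tendsto_atTop.mp hf 0] with n hn
  simp [Int.toNat_of_nonneg hn]

theorem exists_norm_qPoch_le (a : R) (hq : ‖q‖ < 1) : ∃ C, 0 ≤ C ∧ ∀ n, ‖qPoch a q n‖ ≤ C :=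
  exists_norm_le_of_tendsto (tendsto_qPoch a hq)

theorem exists_norm_invPoch_le (hq : ‖q‖ < 1) : ∃ C, 0 ≤ C ∧ ∀ m, ‖invPoch q m‖ ≤ C := by
  obtain ⟨C, h0, hC⟩ := exists_norm_le_of_tendsto (isUnit_qPochInf_and_tendsto_invPoch hq).2
  refine ⟨C, h0, fun m => ?_⟩
  rcases lt_or_ge m 0 with h | h
  · simpa [invPoch_of_neg q h] using h0
  · lift m to ℕ using h
    exact hC m

/-- Bounded because 1/(q;q²)_n = (q²;q²)_n / (q;q)_{2n}. -/
theorem exists_norm_inverse_qPoch_odd_le (hq : ‖q‖ < 1) :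
    ∃ C, 0 ≤ C ∧ ∀ n, ‖Ring.inverse (qPoch q (q ^ 2) n)‖ ≤ C := by
  obtain ⟨A, hA0, hA⟩ := exists_norm_qPoch_le (q ^ 2) (norm_pow_lt_one hq two_ne_zero)
  obtain ⟨B, hB0, hB⟩ := exists_norm_invPoch_le hq
  refine ⟨A * B, by positivity, fun n => ?_⟩
  have hu := isUnit_one_sub_pow_succ hq
  have h1 := Ring.mul_inverse_cancel _ (isUnit_qPoch_odd hu n)
  have h2 := qPoch_mul_invPoch hu (2 * n)
  rw [← qPoch_odd_mul_even] at h2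
  rw [show Ring.inverse (qPoch q (q ^ 2) n) = qPoch (q ^ 2) (q ^ 2) n * invPoch q (2 * n : ℕ) by
    apply (isUnit_qPoch_odd hu n).mul_left_cancel
    rw [h1, ← mul_assoc, h2]]
  exact (norm_mul_le _ _).trans (mul_le_mul (hA _) (hB _) (norm_nonneg _) hA0)

/-- Tannery's theorem: for fixed `j` both reciprocals tend to 1/(q;q)_∞, and C² ‖θ_j‖ dominates,
where θ_j is `thetaTerm x j` and C bounds the reciprocals. -/
theorem tendsto_baileySum_thetaTerm (hq : ‖q‖ < 1) {d : ℕ} (hd : d ≠ 0) {x : R} (hx : ‖x‖ < 1) :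
    Tendsto (baileySum d q (thetaTerm x)) atTop
      (𝓝 ((∑' j, thetaTerm x j) * Ring.inverse (qPochInf q q) ^ 2)) := by
  obtain ⟨C, hC0, hC⟩ := exists_norm_invPoch_le hq
  have h : Tendsto (fun n : ℕ => ∑' j : ℕ, thetaTerm x j *
      (invPoch q (n - (d * j : ℕ)) * invPoch q (n + (d * j : ℕ)))) atTop
      (𝓝 (∑' j, thetaTerm x j * Ring.inverse (qPochInf q q) ^ 2)) := by
    refine tendsto_tsum_of_dominated_convergence ((summable_norm_thetaTerm hx).mul_right (C * C))
      (fun j => ?_) (Eventually.of_forall fun n j => ?_)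
    · rw [sq]
      exact ((tendsto_invPoch hq (tendsto_atTop_add_const_right _ _
        tendsto_natCast_atTop_atTop)).mul (tendsto_invPoch hq (tendsto_atTop_add_const_right _ _
        tendsto_natCast_atTop_atTop))).const_mul _
    · refine (norm_mul_le _ _).trans (mul_le_mul_of_nonneg_left ?_ (norm_nonneg _))
      exact (norm_mul_le _ _).trans (mul_le_mul (hC _) (hC _) (norm_nonneg _) hC0)
  rw [← (summable_norm_thetaTerm hx).of_norm.tsum_mul_right]
  refine h.congr fun n => ?_
  rw [baileySum]
  refine tsum_eq_sum fun j hj => ?_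
  have h1 : n < j := by simpa using hj
  have h2 : j ≤ d * j := Nat.le_mul_of_pos_left j (by omega)
  rw [invPoch_of_neg q (m := n - (d * j : ℕ)) (by omega)]
  ring

/-- Gauss's product for the theta series, from the Jacobi triple product at `z = -1`. -/
theorem tsum_thetaTerm {x : R} (hx : ‖x‖ < 1) :
    ∑' j, thetaTerm x j =
      qPochInf x (x ^ 2) * qPochInf x (x ^ 2) * qPochInf (x ^ 2) (x ^ 2) := by
  have hu := isUnit_one_sub_pow_succ hx
  have hx2 := norm_pow_lt_one hx two_ne_zero
  -- The limit of the shortest chain gives Θ = (x;x)_∞ / (-x;x)_∞ for the theta series Θ. Euler's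
  -- (-x;x)_∞ (x;x²)_∞ = 1, in `h5`, rewrites this as Gauss's product.
  have h1 : Ring.inverse (qPochInf x x) =
      qPochInf (-x) x * ((∑' j, thetaTerm x j) * Ring.inverse (qPochInf x x) ^ 2) :=
    tendsto_nhds_unique (isUnit_qPochInf_and_tendsto_invPoch hx).2
      (((tendsto_qPoch (-x) hx).mul (tendsto_baileySum_thetaTerm hx one_ne_zero hx)).congr
        fun n => (sum_baileySum_thetaTerm_one hu n).symm)
  have h2 : qPochInf x (x ^ 2) * qPochInf (x ^ 2) (x ^ 2) = qPochInf x x :=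
    tendsto_nhds_unique ((tendsto_qPoch x hx2).mul (tendsto_qPoch (x ^ 2) hx2))
      (((tendsto_qPoch x hx).comp (tendsto_id.const_mul_atTop' two_pos)).congr
        fun n => (qPoch_odd_mul_even x n).symm)
  have h3 : qPochInf x x * qPochInf (-x) x = qPochInf (x ^ 2) (x ^ 2) :=
    tendsto_nhds_unique ((tendsto_qPoch x hx).mul (tendsto_qPoch (-x) hx))
      ((tendsto_qPoch (x ^ 2) hx2).congr fun n => (qPoch_mul_neg x n).symm)
  have h4 := Ring.mul_inverse_cancel _ (isUnit_qPochInf hx)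
  have h5 : qPochInf (-x) x * qPochInf x (x ^ 2) = 1 :=
    (isUnit_qPochInf hx).mul_left_cancel (by linear_combination qPochInf x (x ^ 2) * h3 + h2)
  generalize Ring.inverse (qPochInf x x) = y at h1 h4
  generalize qPochInf x x = z at *
  have h6 : z = qPochInf (-x) x * ∑' j, thetaTerm x j := by
    linear_combination z ^ 2 * h1 + (-z + qPochInf (-x) x * (∑' j, thetaTerm x j) * (1 + z * y)) * h4
  linear_combination (-(∑' j, thetaTerm x j)) * h5 - qPochInf x (x ^ 2) * h6 +
    (-qPochInf x (x ^ 2)) * h2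

/-- Let L → ∞ in `h`. The left side tends to Σ t / (q;q)_∞ by dominated convergence and the right
side to (-q;q)_∞ Θ / (q;q)_∞², Θ being the theta series in `x`; one factor cancels. -/
theorem hasSum_of_sum_eq_baileySum (hq : ‖q‖ < 1) {d : ℕ} (hd : d ≠ 0) {x : R} (hx : ‖x‖ < 1)
    (t : ℕ → ℕ → R) (ht : Summable fun p : ℕ × ℕ => ‖t p.1 p.2‖)
    (h0 : ∀ N r, N < r → t N r = 0)
    (h : ∀ L : ℕ, ∑ N ∈ Finset.range (L + 1), invPoch q (L - N) *
      ∑ r ∈ Finset.range (N + 1), t N r = qPoch (-q) q L * baileySum d q (thetaTerm x) L) :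
    HasSum (fun p : ℕ × ℕ => t p.1 p.2)
      (qPochInf x (x ^ 2) * qPochInf x (x ^ 2) * qPochInf (x ^ 2) (x ^ 2) * qPochInf (-q) q *
        Ring.inverse (qPochInf q q)) := by
  obtain ⟨C, hC0, hC⟩ := exists_norm_invPoch_le hq
  have h1 : Tendsto (fun L : ℕ => ∑' p : ℕ × ℕ, invPoch q (L - p.1) * t p.1 p.2) atTop
      (𝓝 (∑' p : ℕ × ℕ, Ring.inverse (qPochInf q q) * t p.1 p.2)) := by
    refine tendsto_tsum_of_dominated_convergence (ht.mul_left C)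
      (fun p => ?_) (Eventually.of_forall fun n p => ?_)
    · exact (tendsto_invPoch hq (tendsto_atTop_add_const_right _ _
        tendsto_natCast_atTop_atTop)).mul_const _
    · exact (norm_mul_le _ _).trans (mul_le_mul_of_nonneg_right (hC _) (norm_nonneg _))
  have h2 : ∀ L : ℕ, ∑' p : ℕ × ℕ, invPoch q (L - p.1) * t p.1 p.2 =
      qPoch (-q) q L * baileySum d q (thetaTerm x) L := by
    intro L
    rw [← h L, tsum_eq_sum (s := Finset.range (L + 1) ×ˢ Finset.range (L + 1)),
      Finset.sum_product]
    · refine Finset.sum_congr rfl fun N hN => ?_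
      rw [Finset.mul_sum]
      refine (Finset.sum_subset (Finset.range_mono (by simpa using hN)) fun r _ hr => ?_).symm
      rw [h0 N r (by simpa using hr), mul_zero]
    · rintro ⟨N, r⟩ hp
      rcases lt_or_ge L N with hN | hN
      · rw [invPoch_of_neg q (m := L - N) (by omega), zero_mul]
      · rw [h0 N r, mul_zero]
        simp only [Finset.mem_product, Finset.mem_range, not_and_or, not_lt] at hp
        omega
  have h3 := tendsto_nhds_unique (h1.congr h2)
    ((tendsto_qPoch (-q) hq).mul (tendsto_baileySum_thetaTerm hq hd hx))
  rw [ht.of_norm.tsum_mul_left, tsum_thetaTerm hx] at h3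
  have h4 := Ring.mul_inverse_cancel _ (isUnit_qPochInf hq)
  suffices hs : ∑' p : ℕ × ℕ, t p.1 p.2 = qPochInf x (x ^ 2) * qPochInf x (x ^ 2) *
      qPochInf (x ^ 2) (x ^ 2) * qPochInf (-q) q * Ring.inverse (qPochInf q q) by
    rw [← hs]; exact ht.of_norm.hasSum
  generalize Ring.inverse (qPochInf q q) = y at *
  generalize qPochInf q q = z at *
  generalize ∑' p : ℕ × ℕ, t p.1 p.2 = T at *
  linear_combination z * h3 - (T - y * qPochInf (-q) q *
    (qPochInf x (x ^ 2) * qPochInf x (x ^ 2) * qPochInf (x ^ 2) (x ^ 2))) * h4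

theorem le_choose_two_succ (N : ℕ) : N ≤ (N + 1).choose 2 := by
  rw [Nat.choose_succ_succ' N 1, Nat.choose_one_right]
  exact Nat.le_add_right _ _

theorem hasSum_doubleSum_nine (hq : ‖q‖ < 1) :
    HasSum
      (fun p : ℕ × ℕ =>
        q ^ ((p.1 ^ 2 + p.1 + 2 * p.1 * p.2 + 3 * p.2 ^ 2 + p.2) / 2) * qPoch (-1) q (p.1 + p.2) *
          Ring.inverse (qPoch q q p.1 * qPoch q q p.2 * qPoch q (q ^ 2) p.2))
      (qPochInf (q ^ 9) (q ^ 18) * qPochInf (q ^ 9) (q ^ 18) * qPochInf (q ^ 18) (q ^ 18) *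
        qPochInf (-q) q * Ring.inverse (qPochInf q q)) := by
  obtain ⟨A, hA0, hA⟩ := exists_norm_qPoch_le (-1) hq
  obtain ⟨B, hB0, hB⟩ := exists_norm_invPoch_le hq
  obtain ⟨C, hC0, hC⟩ := exists_norm_inverse_qPoch_odd_le hq
  have key := hasSum_of_sum_eq_baileySum hq two_ne_zero (norm_pow_lt_one hq (n := 9) (by simp))
    _ ?_ ?_ (sum_baileySum_thetaTerm_nine (isUnit_one_sub_pow_succ hq))
  · rw [← pow_mul q 9 2] at key
    -- The chain is indexed by N = n + r; pairs (N, r) outside the image have N < r and contribute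
    -- 0.
    have hinj : Function.Injective fun p : ℕ × ℕ => (p.1 + p.2, p.2) := by
      rintro ⟨a, b⟩ ⟨c, d⟩ h
      simp only [Prod.mk.injEq] at h ⊢
      omega
    rw [← hinj.hasSum_iff] at key
    · refine key.congr_fun ?_
      rintro ⟨n, r⟩
      have he : (n ^ 2 + n + 2 * n * r + 3 * r ^ 2 + r) / 2 = (n + r + 1).choose 2 + r ^ 2 := by
        apply Nat.div_eq_of_eq_mul_right two_pos
        linear_combination -two_mul_choose_two (n + r)
      simp only [Function.comp_apply, he, Ring.mul_inverse_rev, invPoch_natCast]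
      rw [show ((n + r : ℕ) : ℤ) - r = n by push_cast; ring, invPoch_natCast]
      ring
    · rintro ⟨N, r⟩ h
      rw [invPoch_of_neg q (m := N - r)]
      · ring
      · by_contra! h'
        exact h ⟨(N - r, r), by simp only [Prod.mk.injEq, and_true]; omega⟩
  · refine (summable_norm_pow_mul hq (fun N r => (N + 1).choose 2 + r ^ 2) (fun N r =>
      add_le_add (le_choose_two_succ N) (Nat.le_self_pow two_ne_zero r))
      (fun N r => qPoch (-1) q N * (invPoch q (N - r) *
        (invPoch q r * Ring.inverse (qPoch q (q ^ 2) r)))) (C := A * (B * (B * C)))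
      fun N r => ?_).congr fun p => ?_
    · refine (norm_mul_le _ _).trans (mul_le_mul (hA _) ?_ (norm_nonneg _) hA0)
      refine (norm_mul_le _ _).trans (mul_le_mul (hB _) ?_ (norm_nonneg _) hB0)
      exact (norm_mul_le _ _).trans (mul_le_mul (hB _) (hC _) (norm_nonneg _) hB0)
    · congr 1
      ring
  · intro N r h
    rw [invPoch_of_neg q (m := N - r) (by omega)]
    ring

theorem hasSum_doubleSum_twentyTwo (hq : ‖q‖ < 1) :
    HasSum
      (fun p : ℕ × ℕ =>
        if 2 * p.2 ≤ p.1 then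
          q ^ (p.1 * (p.1 + 1) / 2 + 2 * p.2 ^ 2) * qPoch (-1) q p.1 *
            Ring.inverse (qPoch q (q ^ 2) p.1 * qPoch (q ^ 2) (q ^ 2) p.2 *
              qPoch (q ^ 2) (q ^ 4) p.2 * qPoch q q (p.1 - 2 * p.2))
        else 0)
      (qPochInf (q ^ 22) (q ^ 44) * qPochInf (q ^ 22) (q ^ 44) * qPochInf (q ^ 44) (q ^ 44) *
        qPochInf (-q) q * Ring.inverse (qPochInf q q)) := by
  have hq2 := norm_pow_lt_one hq two_ne_zero
  obtain ⟨A, hA0, hA⟩ := exists_norm_qPoch_le (-1) hq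
  obtain ⟨B, hB0, hB⟩ := exists_norm_invPoch_le hq
  obtain ⟨C, hC0, hC⟩ := exists_norm_inverse_qPoch_odd_le hq
  obtain ⟨B', hB0', hB'⟩ := exists_norm_invPoch_le hq2
  obtain ⟨C', hC0', hC'⟩ := exists_norm_inverse_qPoch_odd_le hq2
  have key := hasSum_of_sum_eq_baileySum hq four_ne_zero (norm_pow_lt_one hq (n := 22) (by simp))
    _ ?_ ?_ (sum_baileySum_thetaTerm_twentyTwo (isUnit_one_sub_pow_succ hq))
  · rw [← pow_mul q 22 2] at key
    refine key.congr_fun ?_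
    rintro ⟨n, r⟩
    have he : n * (n + 1) / 2 = (n + 1).choose 2 :=
      Nat.div_eq_of_eq_mul_right two_pos (two_mul_choose_two n).symm
    simp only [he, ← pow_mul]
    split_ifs with h
    · rw [show (n : ℤ) - (2 * r : ℕ) = (n - 2 * r : ℕ) by omega]
      simp only [Ring.mul_inverse_rev, invPoch_natCast]
      ring
    · rw [invPoch_of_neg q (m := n - (2 * r : ℕ)) (by omega)]
      ring
  · refine (summable_norm_pow_mul hq (fun N r => (N + 1).choose 2 + 2 * r ^ 2) (fun N r =>
      add_le_add (le_choose_two_succ N) ((Nat.le_self_pow two_ne_zero r).trans (by omega)))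
      (fun N r => qPoch (-1) q N * (Ring.inverse (qPoch q (q ^ 2) N) *
        (invPoch q (N - (2 * r : ℕ)) * (invPoch (q ^ 2) r *
          Ring.inverse (qPoch (q ^ 2) ((q ^ 2) ^ 2) r))))) (C := A * (C * (B * (B' * C'))))
      fun N r => ?_).congr fun p => ?_
    · refine (norm_mul_le _ _).trans (mul_le_mul (hA _) ?_ (norm_nonneg _) hA0)
      refine (norm_mul_le _ _).trans (mul_le_mul (hC _) ?_ (norm_nonneg _) hC0)
      refine (norm_mul_le _ _).trans (mul_le_mul (hB _) ?_ (norm_nonneg _) hB0)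
      exact (norm_mul_le _ _).trans (mul_le_mul (hB' _) (hC' _) (norm_nonneg _) hB0')
    · congr 1
      ring
  · intro N r h
    rw [invPoch_of_neg q (m := N - (2 * r : ℕ)) (by omega)]
    ring

end Limits

/-! ### Formal power series with the X-adic norm -/

section XAdic

open Filter Topology

/-- Integral formal power series, to be equipped with the `X`-adic norm. -/
def XAdic : Type := PowerSeries ℤ

noncomputable instance : CommRing XAdic := inferInstanceAs (CommRing (PowerSeries ℤ))

namespace XAdic

/-- The identity map, from the `X`-adically normed ring to the ring of formal power series. -/
noncomputable def toPowerSeries : XAdic ≃+* PowerSeries ℤ := RingEquiv.refl _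

open Classical in
/-- The `X`-adic norm `2 ^ (-order f)`. -/
noncomputable instance : Norm XAdic where
  norm f := if f = 0 then 0 else (1 / 2) ^ (toPowerSeries f).order.toNat

/-- Reduces the ultrametric, product and completeness properties of the norm to vanishing of
coefficients. -/
theorem norm_le_iff {f : XAdic} {n : ℕ} :
    ‖f‖ ≤ (1 / 2) ^ n ↔ ∀ i < n, PowerSeries.coeff i (toPowerSeries f) = 0 := by
  by_cases hf : f = 0
  · simp [hf, Norm.norm]
  · have h0 : toPowerSeries f ≠ 0 := by simpa using hf
    have h1 : ‖f‖ = (1 / 2) ^ (toPowerSeries f).order.toNat := if_neg hf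
    have h2 : ((toPowerSeries f).order.toNat : ℕ∞) = (toPowerSeries f).order :=
      ENat.natCast_toNat (by simpa [PowerSeries.order_eq_top] using h0)
    rw [h1, pow_le_pow_iff_right_of_lt_one₀ (by norm_num) (by norm_num), ← Nat.cast_le (α := ℕ∞), h2]
    exact ⟨fun h i hi => PowerSeries.coeff_of_lt_order i (lt_of_lt_of_le (by exact_mod_cast hi) h),
      fun h => PowerSeries.nat_le_order _ _ h⟩

theorem norm_eq_zero_or (f : XAdic) : ‖f‖ = 0 ∨ ∃ n : ℕ, ‖f‖ = (1 / 2) ^ n := by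
  by_cases hf : f = 0
  · exact Or.inl (if_pos hf)
  · exact Or.inr ⟨_, if_neg hf⟩

theorem norm_nonneg' (f : XAdic) : 0 ≤ ‖f‖ := by
  rcases norm_eq_zero_or f with h | ⟨n, h⟩ <;> rw [h]
  positivity

theorem norm_zero' : ‖(0 : XAdic)‖ = 0 := if_pos rfl

theorem eq_zero_of_norm {f : XAdic} (h : ‖f‖ = 0) : f = 0 := by
  by_contra hf
  rw [show ‖f‖ = _ from if_neg hf] at h
  exact absurd h (by positivity)

theorem norm_add_le_max' (f g : XAdic) : ‖f + g‖ ≤ max ‖f‖ ‖g‖ := by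
  wlog h : ‖f‖ ≤ ‖g‖ generalizing f g
  · rw [add_comm, max_comm]; exact this g f (le_of_not_ge h)
  rw [max_eq_right h]
  rcases norm_eq_zero_or g with hg | ⟨n, hg⟩
  · rw [eq_zero_of_norm hg, eq_zero_of_norm (le_antisymm (h.trans hg.le) (norm_nonneg' f)), add_zero]
  · rw [hg] at h ⊢
    have h' := norm_le_iff.mp hg.le
    rw [norm_le_iff] at h ⊢
    intro i hi
    rw [map_add, map_add, h i hi, h' i hi, add_zero]

theorem norm_mul_le' (f g : XAdic) : ‖f * g‖ ≤ ‖f‖ * ‖g‖ := by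
  rcases norm_eq_zero_or f with hf | ⟨m, hf⟩
  · rw [eq_zero_of_norm hf, zero_mul, norm_zero', zero_mul]
  rcases norm_eq_zero_or g with hg | ⟨n, hg⟩
  · rw [eq_zero_of_norm hg, mul_zero, norm_zero', mul_zero]
  rw [hf, hg, ← pow_add]
  have h1 := norm_le_iff.mp hf.le
  have h2 := norm_le_iff.mp hg.le
  rw [norm_le_iff]
  rw [← PowerSeries.X_pow_dvd_iff] at h1 h2 ⊢
  rw [pow_add, map_mul]
  exact mul_dvd_mul h1 h2

theorem norm_neg' (f : XAdic) : ‖-f‖ = ‖f‖ := by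
  have h : ∀ f : XAdic, ‖-f‖ ≤ ‖f‖ := fun f => by
    rcases norm_eq_zero_or f with hf | ⟨m, hf⟩
    · rw [eq_zero_of_norm hf, neg_zero]
    · rw [hf]
      have := norm_le_iff.mp hf.le
      rw [norm_le_iff]
      intro i hi
      rw [map_neg, map_neg, this i hi, neg_zero]
  exact le_antisymm (h f) (by simpa using h (-f))

noncomputable instance : NormedCommRing XAdic where
  dist f g := ‖-f + g‖
  dist_eq _ _ := rfl
  dist_self f := by rw [neg_add_cancel]; exact norm_zero'
  dist_comm f g := by rw [← norm_neg']; congr 1; ring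
  dist_triangle f g h := by
    rw [show -f + h = (-f + g) + (-g + h) by ring]
    exact (norm_add_le_max' _ _).trans (max_le_add_of_nonneg (norm_nonneg' _) (norm_nonneg' _))
  eq_of_dist_eq_zero {f g} h := by
    have := eq_zero_of_norm h
    linear_combination -this
  norm_mul_le := norm_mul_le'
  mul_comm := mul_comm

theorem coeff_eq_of_dist_le {f g : XAdic} {n i : ℕ} (h : dist f g ≤ (1 / 2) ^ n) (hi : i < n) :
    PowerSeries.coeff i (toPowerSeries f) = PowerSeries.coeff i (toPowerSeries g) := by
  rw [dist_eq_norm] at h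
  have := norm_le_iff.mp h i hi
  rwa [map_sub, map_sub, sub_eq_zero] at this

instance : CompleteSpace XAdic := by
  refine Metric.complete_of_convergent_controlled_sequences (fun n => (1 / 2) ^ n)
    (fun n => by positivity) fun u hu => ?_
  -- From index `i + 1` on, the sequence agrees modulo X^(i+1), so its i-th coefficient has
  -- stabilised.
  refine ⟨toPowerSeries.symm (PowerSeries.mk fun i =>
    PowerSeries.coeff i (toPowerSeries (u (i + 1)))), ?_⟩
  rw [Metric.tendsto_atTop]
  intro ε hε
  obtain ⟨N, hN⟩ := exists_pow_lt_of_lt_one hε (by norm_num : (1 / 2 : ℝ) < 1)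
  refine ⟨N, fun n hn => lt_of_le_of_lt ?_ hN⟩
  rw [dist_eq_norm, norm_le_iff]
  intro i hi
  rw [map_sub, map_sub, RingEquiv.apply_symm_apply, PowerSeries.coeff_mk, sub_eq_zero]
  exact coeff_eq_of_dist_le (hu (i + 1) n (i + 1) (by omega) le_rfl).le (Nat.lt_succ_self i)

/-- Each coefficient is locally constant in the X-adic topology. This carries sums and infinite
products over to the product topology. -/
theorem continuous_toPowerSeries : Continuous toPowerSeries := by
  rw [continuous_iff_continuousAt]
  intro f
  rw [ContinuousAt, PowerSeries.WithPiTopology.tendsto_iff_coeff_tendsto]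
  intro d
  refine tendsto_const_nhds.congr' ?_
  filter_upwards [Metric.ball_mem_nhds f (show (0 : ℝ) < (1 / 2) ^ (d + 1) by positivity)] with g hg
  rw [Metric.mem_ball'] at hg
  exact coeff_eq_of_dist_le hg.le (Nat.lt_succ_self d)

theorem norm_symm_X_pow (n : ℕ) : ‖toPowerSeries.symm (PowerSeries.X ^ n)‖ = (1 / 2) ^ n := by
  have h : toPowerSeries.symm (PowerSeries.X ^ n) ≠ 0 := by
    rw [Ne, map_eq_zero_iff _ toPowerSeries.symm.injective]
    exact pow_ne_zero n PowerSeries.X_ne_zero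
  rw [show ‖toPowerSeries.symm (PowerSeries.X ^ n)‖ = _ from if_neg h, RingEquiv.apply_symm_apply,
    PowerSeries.order_X_pow, ENat.toNat_natCast]

instance : NormOneClass XAdic where
  norm_one := by simpa using norm_symm_X_pow 0

theorem norm_symm_X_lt_one : ‖toPowerSeries.symm PowerSeries.X‖ < 1 := by
  have := norm_symm_X_pow 1
  rw [pow_one, pow_one] at this
  rw [this]
  norm_num

end XAdic

theorem map_qPoch {R S F : Type*} [CommRing R] [CommRing S] [FunLike F R S] [RingHomClass F R S]
    (φ : F) (a q : R) (n : ℕ) : φ (qPoch a q n) = qPoch (φ a) (φ q) n := by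
  simp [qPoch, map_prod]

theorem XAdic.toPowerSeries_qPochInf (a : XAdic) {q : XAdic} (hq : ‖q‖ < 1) :
    toPowerSeries (qPochInf a q) = qPochInf (toPowerSeries a) (toPowerSeries q) := by
  have h := (multipliable_one_sub_mul_pow a hq).map_tprod toPowerSeries
    XAdic.continuous_toPowerSeries
  simpa [qPochInf] using h

theorem XAdic.toPowerSeries_inverse {f : XAdic}
    (hf : PowerSeries.constantCoeff (toPowerSeries f) = 1) :
    toPowerSeries (Ring.inverse f) = recip (toPowerSeries f) := by
  have h := mul_recip _ hf
  have hu : IsUnit (toPowerSeries f) := IsUnit.of_mul_eq_one _ h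
  have hu' : IsUnit f := (MulEquiv.isUnit_map toPowerSeries).mp hu
  apply hu.mul_left_cancel
  rw [h, ← map_mul, Ring.mul_inverse_cancel _ hu', map_one]

end XAdic

/-! ### Specialisation to complex numbers and to formal power series -/

theorem mainTheorem12 :
    -- the two identities for complex `q` in the open unit disc
    (∀ q : ℂ, ‖q‖ < 1 →
      HasSum
        (fun p : ℕ × ℕ =>
          q ^ ((p.1 ^ 2 + p.1 + 2 * p.1 * p.2 + 3 * p.2 ^ 2 + p.2) / 2) * qPoch (-1) q (p.1 + p.2) /
            (qPoch q q p.1 * qPoch q q p.2 * qPoch q (q ^ 2) p.2))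
        (qPochInf (q ^ 9) (q ^ 18) * qPochInf (q ^ 9) (q ^ 18) * qPochInf (q ^ 18) (q ^ 18) *
          qPochInf (-q) q / qPochInf q q) ∧
      HasSum
        (fun p : ℕ × ℕ =>
          if 2 * p.2 ≤ p.1 then
            q ^ (p.1 * (p.1 + 1) / 2 + 2 * p.2 ^ 2) * qPoch (-1) q p.1 /
              (qPoch q (q ^ 2) p.1 * qPoch (q ^ 2) (q ^ 2) p.2 * qPoch (q ^ 2) (q ^ 4) p.2 *
                qPoch q q (p.1 - 2 * p.2))
          else 0)
        (qPochInf (q ^ 22) (q ^ 44) * qPochInf (q ^ 22) (q ^ 44) * qPochInf (q ^ 44) (q ^ 44) *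
          qPochInf (-q) q / qPochInf q q)) ∧
    -- the two identities for formal power series in the indeterminate `q` over `ℤ`
    (∀ q : PowerSeries ℤ, q = PowerSeries.X →
      HasSum
        (fun p : ℕ × ℕ =>
          q ^ ((p.1 ^ 2 + p.1 + 2 * p.1 * p.2 + 3 * p.2 ^ 2 + p.2) / 2) * qPoch (-1) q (p.1 + p.2) *
            recip (qPoch q q p.1 * qPoch q q p.2 * qPoch q (q ^ 2) p.2))
        (qPochInf (q ^ 9) (q ^ 18) * qPochInf (q ^ 9) (q ^ 18) * qPochInf (q ^ 18) (q ^ 18) *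
          qPochInf (-q) q * recip (qPochInf q q)) ∧
      HasSum
        (fun p : ℕ × ℕ =>
          if 2 * p.2 ≤ p.1 then
            q ^ (p.1 * (p.1 + 1) / 2 + 2 * p.2 ^ 2) * qPoch (-1) q p.1 *
              recip (qPoch q (q ^ 2) p.1 * qPoch (q ^ 2) (q ^ 2) p.2 * qPoch (q ^ 2) (q ^ 4) p.2 *
                qPoch q q (p.1 - 2 * p.2))
          else 0)
        (qPochInf (q ^ 22) (q ^ 44) * qPochInf (q ^ 22) (q ^ 44) * qPochInf (q ^ 44) (q ^ 44) *
          qPochInf (-q) q * recip (qPochInf q q))) := by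
  refine ⟨fun q hq => ⟨?_, ?_⟩, ?_⟩
  · simpa only [Ring.inverse_eq_inv', div_eq_mul_inv] using hasSum_doubleSum_nine hq
  · simpa only [Ring.inverse_eq_inv', div_eq_mul_inv] using hasSum_doubleSum_twentyTwo hq
  rintro q rfl
  have hX : ‖XAdic.toPowerSeries.symm PowerSeries.X‖ < 1 := XAdic.norm_symm_X_lt_one
  have hpow : ∀ n : ℕ, n ≠ 0 → ‖XAdic.toPowerSeries.symm PowerSeries.X ^ n‖ < 1 :=
    fun n hn => norm_pow_lt_one hX hn
  have hc : PowerSeries.constantCoeff (qPochInf (PowerSeries.X : PowerSeries ℤ) PowerSeries.X) = 1 :=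
    constantCoeff_qPochInf _ _ (by simp) (by simp)
  constructor
  · have h := (hasSum_doubleSum_nine hX).map XAdic.toPowerSeries XAdic.continuous_toPowerSeries
    rw [map_mul, XAdic.toPowerSeries_inverse] at h
    · simp only [map_mul, XAdic.toPowerSeries_qPochInf _ hX,
        XAdic.toPowerSeries_qPochInf _ (hpow 18 (by simp)), map_pow, map_neg,
        RingEquiv.apply_symm_apply] at h
      refine h.congr_fun fun p => ?_
      rw [Function.comp_apply, map_mul, XAdic.toPowerSeries_inverse]
      · simp only [map_mul, map_qPoch, map_pow, map_neg, map_one, RingEquiv.apply_symm_apply]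
      · simp only [map_mul, map_qPoch, map_pow, RingEquiv.apply_symm_apply]
        simp [qPoch]
    · rw [XAdic.toPowerSeries_qPochInf _ hX, RingEquiv.apply_symm_apply, hc]
  · have h := (hasSum_doubleSum_twentyTwo hX).map XAdic.toPowerSeries
      XAdic.continuous_toPowerSeries
    rw [map_mul, XAdic.toPowerSeries_inverse] at h
    · simp only [map_mul, XAdic.toPowerSeries_qPochInf _ hX,
        XAdic.toPowerSeries_qPochInf _ (hpow 44 (by simp)), map_pow, map_neg,
        RingEquiv.apply_symm_apply] at h
      refine h.congr_fun fun p => ?_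
      rw [Function.comp_apply]
      split_ifs
      · rw [map_mul, XAdic.toPowerSeries_inverse]
        · simp only [map_mul, map_qPoch, map_pow, map_neg, map_one, RingEquiv.apply_symm_apply]
        · simp only [map_mul, map_qPoch, map_pow, RingEquiv.apply_symm_apply]
          simp [qPoch]
      · rw [map_zero]
    · rw [XAdic.toPowerSeries_qPochInf _ hX, RingEquiv.apply_symm_apply, hc]
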